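/- Let $K$ be a field of characteristic $0$, let $L$ be the free Lie algebra over $K$ on two generators $x,y$, and let $\delta$ be the derivation of $L$ with $\delta(x)=0$ and $\delta(y)=x$. Write $L^{\delta}=\{a\in L:\delta(a)=0\}$, and let $[a_1,a_2,\ldots,a_m]=[[\ldots[a_1,a_2],\ldots],a_m]$ denote left-normed products. Let $f\in L$ be a nonzero multihomogeneous element (that is, for some $p,q$, a linear combination of Lie monomials each containing exactly $p$ letters $x$ and $q$ letters $y$) with $\deg_y(f)=q=3$ and total degree $\deg(f)=p+q=n$. Then $f\in L^{\delta}$ if and only if $f$ belongs to the Lie subalgebra of $L$ generated by $x$, $[y,x]$ and the elements \[ [y,\underbrace{x,\ldots,x}_{k},[y,\underbrace{x,\ldots,x}_{n-3-k},y]]-[y,\underbrace{x,\ldots,x}_{k-1},y,[y,\underbrace{x,\ldots,x}_{n-2-k}]], \] where $k$ runs over the integers with $\frac{n-2}{2}\le k\le n-4$. -/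

import Mathlib

namespace FreeLieConstants

/-- The left-normed product `[a, b₁, b₂, …, bₘ] = [[…[[a, b₁], b₂], …], bₘ]`. -/
def leftNormed {M : Type*} [LieRing M] (a : M) (l : List M) : M :=
  l.foldl (fun u v => ⁅u, v⁆) a

/-- The Lie algebra `M ⊕ ε M` of dual numbers over a Lie algebra `M`, with `ε² = 0`; the element
`a + ε b` is the pair `⟨a, b⟩`. It serves only to construct derivations of a free Lie algebra from
its universal property. -/
@[ext]
structure Dual (M : Type*) where
  fst : M
  snd : M

namespace Dual

variable {K M : Type*} [CommRing K] [LieRing M] [LieAlgebra K M]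

/-- The obvious identification with pairs. -/
def equivProd : Dual M ≃ M × M where
  toFun a := (a.fst, a.snd)
  invFun a := ⟨a.1, a.2⟩
  left_inv _ := rfl
  right_inv _ := rfl

instance : AddCommGroup (Dual M) := equivProd.addCommGroup

instance : Module K (Dual M) := equivProd.module K

@[simp] theorem fst_zero : (0 : Dual M).fst = 0 := rfl
@[simp] theorem snd_zero : (0 : Dual M).snd = 0 := rfl
@[simp] theorem fst_add (a b : Dual M) : (a + b).fst = a.fst + b.fst := rfl
@[simp] theorem snd_add (a b : Dual M) : (a + b).snd = a.snd + b.snd := rfl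
@[simp] theorem fst_smul (t : K) (a : Dual M) : (t • a).fst = t • a.fst := rfl
@[simp] theorem snd_smul (t : K) (a : Dual M) : (t • a).snd = t • a.snd := rfl

instance : Bracket (Dual M) (Dual M) where
  bracket a b := ⟨⁅a.fst, b.fst⁆, ⁅a.fst, b.snd⁆ + ⁅a.snd, b.fst⁆⟩

@[simp] theorem fst_lie (a b : Dual M) : ⁅a, b⁆.fst = ⁅a.fst, b.fst⁆ := rfl
@[simp] theorem snd_lie (a b : Dual M) : ⁅a, b⁆.snd = ⁅a.fst, b.snd⁆ + ⁅a.snd, b.fst⁆ := rfl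

instance : LieRing (Dual M) where
  add_lie a b c := by ext <;> simp; abel
  lie_add a b c := by ext <;> simp; abel
  lie_self a := by
    ext
    · simp
    · rw [snd_lie, ← lie_skew a.fst a.snd, neg_add_cancel]; rfl
  leibniz_lie a b c := by
    ext
    · simp
    · simp only [snd_lie, fst_lie, snd_add, lie_add, add_lie]
      rw [leibniz_lie a.fst b.fst c.snd, leibniz_lie a.fst b.snd c.fst,
        leibniz_lie a.snd b.fst c.fst]
      abel

instance : LieAlgebra K (Dual M) where
  lie_smul t a b := by ext <;> simp

/-- The projection `a + ε b ↦ a`. -/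
def fstHom (K M : Type*) [CommRing K] [LieRing M] [LieAlgebra K M] : Dual M →ₗ⁅K⁆ M where
  toFun a := a.fst
  map_add' _ _ := rfl
  map_smul' _ _ := rfl
  map_lie' := rfl

end Dual

section Rank2

variable (K : Type*) [Field K]

/-- The free Lie algebra `L` of rank two over `K`. -/
abbrev L : Type _ := FreeLieAlgebra K (Fin 2)

/-- The first free generator of `L`. -/
noncomputable def x : L K := FreeLieAlgebra.of K 0

/-- The second free generator of `L`. -/
noncomputable def y : L K := FreeLieAlgebra.of K 1

/-- The homomorphism `a ↦ a + ε δ(a)`, where `δ(x) = 0` and `δ(y) = x`. -/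
noncomputable def deltaHom : L K →ₗ⁅K⁆ Dual (L K) :=
  FreeLieAlgebra.lift K ![⟨x K, 0⟩, ⟨y K, x K⟩]

theorem fst_deltaHom (a : L K) : (deltaHom K a).fst = a := by
  have h : (Dual.fstHom K (L K)).comp (deltaHom K) = LieHom.id := by
    apply FreeLieAlgebra.hom_ext
    intro i
    change (deltaHom K (FreeLieAlgebra.of K i)).fst = FreeLieAlgebra.of K i
    fin_cases i <;> simp [deltaHom, x, y]
  exact LieHom.congr_fun h a

/-- The derivation `δ` of `L` with `δ(x) = 0` and `δ(y) = x`. -/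
noncomputable def delta : LieDerivation K (L K) (L K) where
  toFun a := (deltaHom K a).snd
  map_add' a b := by simp
  map_smul' t a := by simp
  leibniz' a b := by
    change (deltaHom K ⁅a, b⁆).snd = ⁅a, (deltaHom K b).snd⁆ - ⁅b, (deltaHom K a).snd⁆
    rw [LieHom.map_lie, Dual.snd_lie, fst_deltaHom, fst_deltaHom, sub_eq_add_neg, lie_skew]

theorem delta_x : delta K (x K) = 0 := by
  change (deltaHom K (FreeLieAlgebra.of K 0)).snd = 0
  simp [deltaHom]

theorem delta_y : delta K (y K) = x K := by
  change (deltaHom K (FreeLieAlgebra.of K 1)).snd = x K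
  simp [deltaHom]

/-- The Lie subalgebra `L^δ = {a ∈ L | δ(a) = 0}` of constants of `δ`. -/
noncomputable def constants : LieSubalgebra K (L K) where
  carrier := {a | delta K a = 0}
  zero_mem' := by simp
  add_mem' {a b} ha hb := by
    simp only [Set.mem_ofPred_eq] at ha hb ⊢
    rw [map_add, ha, hb, add_zero]
  smul_mem' t a ha := by
    simp only [Set.mem_ofPred_eq] at ha ⊢
    rw [map_smul, ha, smul_zero]
  lie_mem' {a b} ha hb := by
    have ha' : delta K a = 0 := ha
    have hb' : delta K b = 0 := hb
    change delta K ⁅a, b⁆ = 0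
    rw [LieDerivation.apply_lie_eq_sub, ha', hb', lie_zero, lie_zero, sub_zero]

/-- `IsMonomial K p q m`: the element `m` of `L` is the value of an iterated bracket in which
`x` occurs exactly `p` times and `y` exactly `q` times. -/
inductive IsMonomial : ℕ → ℕ → L K → Prop
  | gen_x : IsMonomial 1 0 (x K)
  | gen_y : IsMonomial 0 1 (y K)
  | lie {p q r s : ℕ} {u v : L K} :
      IsMonomial p q u → IsMonomial r s v → IsMonomial (p + r) (q + s) ⁅u, v⁆

/-- The multihomogeneous component of `L` of degree `p` in `x` and `q` in `y`: the linear
combinations of monomials with these degrees. Its nonzero elements are the multihomogeneous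
polynomials `f` with `deg_x f = p` and `deg_y f = q`; they have total degree `p + q`. -/
noncomputable def multihomogeneous (p q : ℕ) : Submodule K (L K) :=
  Submodule.span K {m | IsMonomial K p q m}

/-- The element `[y, x^k, [y, x^(n-3-k), y]] - [y, x^(k-1), y, [y, x^(n-2-k)]]`, with left-normed
products, where `x^j` stands for `x, …, x` (`j` times); it is meant for `1 ≤ k` and `k + 4 ≤ n`,
where no subtraction is truncated. -/
noncomputable def cubicGenerator (n k : ℕ) : L K :=
  leftNormed (y K) (List.replicate k (x K) ++
      [leftNormed (y K) (List.replicate (n - 3 - k) (x K) ++ [y K])])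
    - leftNormed (y K) (List.replicate (k - 1) (x K) ++
      [y K, leftNormed (y K) (List.replicate (n - 2 - k) (x K))])

end Rank2

end FreeLieConstants

/-!
Put `uᵢ = [y, x, …, x]` with `i` letters `x`. Bracketing with `x` on the right sends `uᵢ` to `uᵢ₊₁`,
so the component of degree `(p, 3)` is spanned by the products `[[uᵢ, uⱼ], uₖ]` with
`i + j + k = p`. Moreover `δ u₀ = x` and `δ uᵢ = 0` for `i ≥ 1`.

Let `N` be the subalgebra generated by `x`, `[y, x]` and the cubic elements. It contains every `uᵢ`
with `i ≥ 1`, hence all products `[[uᵢ, uⱼ], uₖ]` with positive indices. By the Jacobi identity the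
remaining ones are, modulo `N`, combinations of `C = [[uₚ, u₀], u₀]` and of
`Bⱼₖ = [[uⱼ, u₀], uₖ]` with `j, k ≥ 1`. The cubic elements are, up to sign, the sums
`B_{i,j+1} + B_{j,i+1}` (`cubicGenerator_eq`), so only the `Bⱼₖ` with `j ≥ k` are needed
(`lie_lie_mem_sup`). Now `δ Bⱼₖ = [uⱼ₊₁, uₖ]` and `δ C = 2 [uₚ₊₁, u₀] + [uₚ, u₁]`, and these
elements are linearly independent. This is seen in the representation `rep` of `L` by `3 × 3`
matrices over `K[X]`, in which the upper right entry of `[u_a, u_b]` is `X ^ a - X ^ b`. Thus a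
constant of degree `(p, 3)` has no component along `C` and the `Bⱼₖ`, and lies in `N`.
-/

namespace FreeLieConstants

open Polynomial

variable (K : Type*) [Field K]

/-! ### The elements `[y, x, …, x]` and their cubic products -/

/-- The element `uᵢ = [y, x, …, x]` with `i` letters `x`. -/
noncomputable def u (i : ℕ) : L K := leftNormed (y K) (List.replicate i (x K))

theorem u_zero : u K 0 = y K := rfl

theorem u_succ (i : ℕ) : u K (i + 1) = ⁅u K i, x K⁆ := by
  simp [u, leftNormed, List.replicate_succ']

theorem lie_x_u (i : ℕ) : ⁅x K, u K i⁆ = -u K (i + 1) := by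
  rw [u_succ, lie_skew]

theorem delta_lie (a b : L K) : delta K ⁅a, b⁆ = ⁅delta K a, b⁆ + ⁅a, delta K b⁆ := by
  rw [LieDerivation.apply_lie_eq_sub, ← lie_skew (delta K a) b]
  abel

theorem delta_u_zero : delta K (u K 0) = x K := delta_y K

theorem delta_u_succ (i : ℕ) : delta K (u K (i + 1)) = 0 := by
  induction i with
  | zero => rw [u_succ, delta_lie, delta_u_zero, delta_x]; simp
  | succ i ih => rw [u_succ, delta_lie, ih, delta_x]; simp

theorem delta_u_of_pos {i : ℕ} (hi : 1 ≤ i) : delta K (u K i) = 0 := by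
  obtain ⟨i, rfl⟩ := Nat.exists_eq_add_of_le' hi
  exact delta_u_succ K i

/-- The element `[[uⱼ, u₀], uₖ]`. -/
noncomputable def B (j k : ℕ) : L K := ⁅⁅u K j, u K 0⁆, u K k⁆

theorem delta_B {j k : ℕ} (hj : 1 ≤ j) (hk : 1 ≤ k) :
    delta K (B K j k) = ⁅u K (j + 1), u K k⁆ := by
  rw [B, delta_lie, delta_lie, delta_u_of_pos K hj, delta_u_of_pos K hk, delta_u_zero, u_succ]
  simp

theorem delta_B_zero {j : ℕ} (hj : 1 ≤ j) :
    delta K (B K j 0) = (2 : K) • ⁅u K (j + 1), u K 0⁆ + ⁅u K j, u K 1⁆ := by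
  rw [B, delta_lie, delta_lie, delta_u_of_pos K hj, delta_u_zero, zero_lie, zero_add, ← u_succ,
    lie_lie, ← u_succ, ← u_succ, ← lie_skew (u K 0), two_smul]
  abel

/-- The cubic element of parameters `n = i + j + 4` and `k = i + 1` is, up to sign, a symmetric
sum. -/
theorem cubicGenerator_eq (i j : ℕ) :
    cubicGenerator K (i + j + 4) (i + 1) = -(B K i (j + 1) + B K j (i + 1)) := by
  have h1 : i + j + 4 - 3 - (i + 1) = j := by omega
  have h2 : i + j + 4 - 2 - (i + 1) = j + 1 := by omega
  have h : cubicGenerator K (i + j + 4) (i + 1) = ⁅u K (i + 1), ⁅u K j, u K 0⁆⁆ - B K i (j + 1) := by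
    rw [cubicGenerator, h1, h2]
    simp only [leftNormed, List.foldl_append, List.foldl_cons, List.foldl_nil,
      Nat.add_sub_cancel]
    rfl
  rw [h, B, B, ← lie_skew]
  abel

/-- The subalgebra generated by `x`, `[y, x]` and the cubic elements of total degree `n`. -/
noncomputable def cubicSubalgebra (n : ℕ) : LieSubalgebra K (L K) :=
  LieSubalgebra.lieSpan K (L K) ({x K, ⁅y K, x K⁆} ∪
    {g | ∃ k : ℕ, ((n : ℚ) - 2) / 2 ≤ (k : ℚ) ∧ (k : ℚ) ≤ (n : ℚ) - 4 ∧
      g = cubicGenerator K n k})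

theorem x_mem_cubicSubalgebra (n : ℕ) : x K ∈ cubicSubalgebra K n :=
  LieSubalgebra.subset_lieSpan (by simp)

theorem u_mem_cubicSubalgebra (n : ℕ) {i : ℕ} (hi : 1 ≤ i) : u K i ∈ cubicSubalgebra K n := by
  induction i, hi using Nat.le_induction with
  | base =>
    rw [u_succ, u_zero]
    exact LieSubalgebra.subset_lieSpan (by simp)
  | succ i _ ih =>
    rw [u_succ]
    exact LieSubalgebra.lie_mem _ ih (x_mem_cubicSubalgebra K n)

theorem B_add_B_mem_cubicSubalgebra {i j n : ℕ} (hi : 1 ≤ i) (hj : 1 ≤ j) (hn : i + j + 4 = n) :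
    B K i (j + 1) + B K j (i + 1) ∈ cubicSubalgebra K n := by
  wlog h : j ≤ i generalizing i j
  · rw [add_comm]
    exact this hj hi (by omega) (by omega)
  subst hn
  rw [← neg_neg (B K i (j + 1) + B K j (i + 1)), ← cubicGenerator_eq]
  have h' : (j : ℚ) ≤ i := by exact_mod_cast h
  have hj' : (1 : ℚ) ≤ j := by exact_mod_cast hj
  refine neg_mem (LieSubalgebra.subset_lieSpan (Or.inr ⟨i + 1, ?_, ?_, rfl⟩)) <;>
  · push_cast
    linarith

theorem cubicSubalgebra_le_constants (n : ℕ) : cubicSubalgebra K n ≤ constants K := by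
  refine LieSubalgebra.lieSpan_le.2 ?_
  rintro g ((rfl | rfl) | ⟨k, h1, h2, rfl⟩)
  · exact delta_x K
  · exact delta_u_succ K 0
  · have hk : k + 4 ≤ n := by
      have : (k : ℚ) + 4 ≤ n := by linarith
      exact_mod_cast this
    have hk' : n ≤ 2 * k + 2 := by
      have : (n : ℚ) ≤ 2 * k + 2 := by linarith
      exact_mod_cast this
    obtain ⟨i, rfl⟩ : ∃ i, k = i + 1 := ⟨k - 1, by omega⟩
    obtain ⟨j, rfl⟩ : ∃ j, n = i + j + 4 := ⟨n - i - 4, by omega⟩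
    change delta K _ = 0
    rw [cubicGenerator_eq, map_neg, map_add, delta_B K (by omega) (by omega),
      delta_B K (by omega) (by omega), ← lie_skew, neg_add_cancel, neg_zero]

/-! ### Spanning sets of the components of degree at most three in `y` -/

theorem lie_mem_span_of_forall {R M : Type*} [CommRing R] [LieRing M] [LieAlgebra R M]
    {S T : Set M} {W : Submodule R M} (h : ∀ s ∈ S, ∀ t ∈ T, ⁅s, t⁆ ∈ W) {a b : M}
    (ha : a ∈ Submodule.span R S) (hb : b ∈ Submodule.span R T) : ⁅a, b⁆ ∈ W := by
  induction ha using Submodule.span_induction with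
  | mem s hs =>
    induction hb using Submodule.span_induction with
    | mem t ht => exact h s hs t ht
    | zero => simp
    | add b c _ _ hb hc => rw [lie_add]; exact add_mem hb hc
    | smul r b _ hb => rw [lie_smul]; exact W.smul_mem r hb
  | zero => simp
  | add a c _ _ ha hc => rw [add_lie]; exact add_mem ha hc
  | smul r a _ ha => rw [smul_lie]; exact W.smul_mem r ha

/-- A set spanning the component of degree `(p, q)` of `L`, for `q ≤ 3`. The value for `q ≥ 4` is
irrelevant. -/
def spanningSet (p : ℕ) : ℕ → Set (L K)
  | 0 => {m | p = 1 ∧ m = x K}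
  | 1 => {u K p}
  | 2 => {m | ∃ i j, i + j = p ∧ m = ⁅u K i, u K j⁆}
  | 3 => {m | ∃ i j k, i + j + k = p ∧ m = ⁅⁅u K i, u K j⁆, u K k⁆}
  | _ => Set.univ

/-- Bracketing with `x` on the right raises the index of one factor at a time. -/
theorem lie_x_mem_span (p q : ℕ) (m : L K) (hm : m ∈ spanningSet K p q) :
    ⁅m, x K⁆ ∈ Submodule.span K (spanningSet K (p + 1) q) := by
  match q with
  | 0 =>
    obtain ⟨-, rfl⟩ := hm
    simp
  | 1 =>
    obtain rfl := hm
    rw [← u_succ]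
    exact Submodule.subset_span rfl
  | 2 =>
    obtain ⟨i, j, rfl, rfl⟩ := hm
    rw [lie_lie, ← u_succ, ← lie_skew (u K j), ← u_succ, sub_neg_eq_add]
    exact add_mem (Submodule.subset_span ⟨i, j + 1, by omega, rfl⟩)
      (Submodule.subset_span ⟨i + 1, j, by omega, rfl⟩)
  | 3 =>
    obtain ⟨i, j, k, rfl, rfl⟩ := hm
    rw [lie_lie ⁅u K i, u K j⁆ (u K k), ← u_succ, ← lie_skew (u K k), lie_lie (u K i) (u K j) (x K),
      ← u_succ, ← lie_skew (u K j), ← u_succ, sub_neg_eq_add, sub_neg_eq_add, add_lie]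
    exact add_mem (Submodule.subset_span ⟨i, j, k + 1, by omega, rfl⟩)
      (add_mem (Submodule.subset_span ⟨i, j + 1, k, by omega, rfl⟩)
        (Submodule.subset_span ⟨i + 1, j, k, by omega, rfl⟩))
  | _ + 4 => exact Submodule.subset_span trivial

theorem lie_mem_span_spanningSet {p q r s : ℕ} {a b : L K} (ha : a ∈ spanningSet K p q)
    (hb : b ∈ spanningSet K r s) :
    ⁅a, b⁆ ∈ Submodule.span K (spanningSet K (p + r) (q + s)) := by
  wlog h : s ≤ q generalizing p q r s a b
  · rw [← lie_skew, add_comm p, add_comm q]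
    exact neg_mem (this hb ha (by omega))
  match q, s with
  | q, 0 =>
    obtain ⟨rfl, rfl⟩ := hb
    exact lie_x_mem_span K p q a ha
  | 0, s + 1 => omega
  | 1, s + 2 => omega
  | 1, 1 =>
    obtain rfl := ha
    obtain rfl := hb
    exact Submodule.subset_span ⟨p, r, rfl, rfl⟩
  | 2, 1 =>
    obtain ⟨i, j, rfl, rfl⟩ := ha
    obtain rfl := hb
    exact Submodule.subset_span ⟨i, j, r, rfl, rfl⟩
  | 2, s + 2 =>
    have : 2 + (s + 2) = s + 4 := by omega
    rw [this]
    exact Submodule.subset_span trivial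
  | q + 3, s + 1 =>
    have : q + 3 + (s + 1) = q + s + 4 := by omega
    rw [this]
    exact Submodule.subset_span trivial

theorem IsMonomial.mem_span {p q : ℕ} {m : L K} (hm : IsMonomial K p q m) :
    m ∈ Submodule.span K (spanningSet K p q) := by
  induction hm with
  | gen_x => exact Submodule.subset_span ⟨rfl, rfl⟩
  | gen_y => exact Submodule.subset_span rfl
  | lie _ _ ih₁ ih₂ =>
    exact lie_mem_span_of_forall (fun _ hs _ ht => lie_mem_span_spanningSet K hs ht) ih₁ ih₂

theorem multihomogeneous_le_span (p q : ℕ) :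
    multihomogeneous K p q ≤ Submodule.span K (spanningSet K p q) :=
  Submodule.span_le.2 fun _ hm => IsMonomial.mem_span K hm

/-! ### Reduction modulo the subalgebra -/

/-- The span of the elements `[[uₚ₋ₖ, u₀], uₖ]` with `k ≤ p - k`. The index `k = 0` gives
`[[uₚ, u₀], u₀]`. -/
noncomputable def complementSpan (p : ℕ) : Submodule K (L K) :=
  Submodule.span K ((fun k => B K (p - k) k) '' (Finset.range (p / 2 + 1) : Finset ℕ))

theorem B_mem_complementSpan {p j k : ℕ} (h : j + k = p) (hkj : k ≤ j) :
    B K j k ∈ complementSpan K p := by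
  refine Submodule.subset_span ⟨k, ?_, ?_⟩
  · simp only [Finset.coe_range, Set.mem_Iio]
    omega
  · simp only
    congr 1
    omega

theorem B_mem_sup [CharZero K] {p n j k : ℕ} (hp : p + 3 = n) (h : j + k = p) (hj : 1 ≤ j) :
    B K j k ∈ (cubicSubalgebra K n).toSubmodule ⊔ complementSpan K p := by
  by_cases hkj : k ≤ j
  · exact Submodule.mem_sup_right (B_mem_complementSpan K h hkj)
  obtain ⟨i, rfl⟩ : ∃ i, k = i + 1 := ⟨k - 1, by omega⟩
  have hs := B_add_B_mem_cubicSubalgebra K (i := j) (j := i) hj (by omega) (n := n) (by omega)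
  rcases eq_or_ne i j with rfl | hij
  · refine Submodule.mem_sup_left ?_
    rw [← two_smul K] at hs
    exact (Submodule.smul_mem_iff _ (two_ne_zero (α := K))).1 hs
  · rw [← add_sub_cancel_right (B K j (i + 1)) (B K i (j + 1))]
    exact sub_mem (Submodule.mem_sup_left hs)
      (Submodule.mem_sup_right (B_mem_complementSpan K (by omega) (by omega)))

theorem lie_lie_mem_sup [CharZero K] {p n i j k : ℕ} (hp : p + 3 = n) (h : i + j + k = p) :
    ⁅⁅u K i, u K j⁆, u K k⁆ ∈ (cubicSubalgebra K n).toSubmodule ⊔ complementSpan K p := by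
  rcases Nat.eq_zero_or_pos j with rfl | hj
  · rcases Nat.eq_zero_or_pos i with rfl | hi
    · simp
    · exact B_mem_sup K hp (by omega) hi
  rcases Nat.eq_zero_or_pos i with rfl | hi
  · rw [← lie_skew (u K 0) (u K j), neg_lie]
    exact neg_mem (B_mem_sup K hp (by omega) hj)
  rcases Nat.eq_zero_or_pos k with rfl | hk
  · have : ⁅⁅u K i, u K j⁆, u K 0⁆ = B K i j - B K j i := by
      rw [lie_lie, B, B, ← lie_skew (u K i), ← lie_skew (u K j) ⁅u K i, u K 0⁆]
      abel
    rw [this]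
    exact sub_mem (B_mem_sup K hp (by omega) hi) (B_mem_sup K hp (by omega) hj)
  · have hu {l : ℕ} (hl : 0 < l) := u_mem_cubicSubalgebra K n hl
    exact Submodule.mem_sup_left
      (LieSubalgebra.lie_mem _ (LieSubalgebra.lie_mem _ (hu hi) (hu hj)) (hu hk))


theorem multihomogeneous_le_sup [CharZero K] {p n : ℕ} (hp : p + 3 = n) :
    multihomogeneous K p 3 ≤ (cubicSubalgebra K n).toSubmodule ⊔ complementSpan K p := by
  refine (multihomogeneous_le_span K p 3).trans (Submodule.span_le.2 ?_)
  rintro _ ⟨i, j, k, h, rfl⟩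
  exact lie_lie_mem_sup K hp h

/-! ### Linear independence of the images under `δ` -/

attribute [local instance] LieRing.ofAssociativeRing

/-- The representation of `L` over `K[X]` with `x ↦ diag(0, X, X + 1)` and `y ↦ E₁₂ + E₂₃`. -/
noncomputable def rep : L K →ₗ⁅K⁆ Matrix (Fin 3) (Fin 3) K[X] :=
  FreeLieAlgebra.lift K ![!![0, 0, 0; 0, X, 0; 0, 0, X + 1], !![0, 1, 0; 0, 0, 1; 0, 0, 0]]

theorem rep_x : rep K (x K) = !![0, 0, 0; 0, X, 0; 0, 0, X + 1] := by
  simp [rep, x]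

theorem rep_y : rep K (y K) = !![0, 1, 0; 0, 0, 1; 0, 0, 0] := by
  simp [rep, y]

theorem rep_u (i : ℕ) : rep K (u K i) = !![0, X ^ i, 0; 0, 0, 1; 0, 0, 0] := by
  induction i with
  | zero => rw [u_zero, rep_y, pow_zero]
  | succ i ih =>
    rw [u_succ, LieHom.map_lie, ih, rep_x, Ring.lie_def]
    ext a b : 2
    fin_cases a <;> fin_cases b <;> simp [pow_succ]

/-- The upper right entry of the matrix `rep a`. -/
noncomputable def corner : L K →ₗ[K] K[X] where
  toFun a := rep K a 0 2
  map_add' a b := by rw [map_add]; rfl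
  map_smul' t a := by rw [map_smul]; rfl

theorem corner_lie_u (i j : ℕ) : corner K ⁅u K i, u K j⁆ = X ^ i - X ^ j := by
  change rep K _ 0 2 = _
  rw [LieHom.map_lie, rep_u, rep_u, Ring.lie_def]
  simp

/-- The coefficient of `X ^ (p + 1 - l)` detects the term of index `l` in a combination of the
`δ [[uₚ₋ₖ, u₀], uₖ]` with `k ≥ 1`. -/
theorem coeff_corner_delta_B {p k l : ℕ} (hk : 1 ≤ k) (hkp : k ≤ p / 2) (hl : l ≤ p / 2) :
    (corner K (delta K (B K (p - k) k))).coeff (p + 1 - l) = if k = l then 1 else 0 := by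
  rw [delta_B K (by omega) hk, corner_lie_u, coeff_sub, coeff_X_pow, coeff_X_pow,
    if_neg (show p + 1 - l ≠ k by omega), sub_zero]
  exact if_congr (by omega) rfl rfl

theorem coeff_corner_delta_B_zero {p : ℕ} (hp : 1 ≤ p) :
    (corner K (delta K (B K p 0))).coeff (p + 1) = 2 := by
  rw [delta_B_zero K hp, map_add, map_smul, corner_lie_u, corner_lie_u]
  simp only [coeff_add, coeff_smul, coeff_sub, coeff_X_pow, smul_eq_mul]
  rw [if_neg (show p + 1 ≠ 0 by omega), if_neg (show p + 1 ≠ p by omega),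
    if_neg (show p + 1 ≠ 1 by omega)]
  simp

theorem eq_zero_of_mem_complementSpan [CharZero K] {p : ℕ} {t : L K}
    (ht : t ∈ complementSpan K p) (hd : delta K t = 0) : t = 0 := by
  rw [complementSpan, Submodule.mem_span_image_finset_iff_exists_fun'] at ht
  obtain ⟨c, rfl⟩ := ht
  rcases Nat.eq_zero_or_pos p with rfl | hp
  · simp [B]
  have key (l : ℕ) : ∑ k ∈ Finset.range (p / 2 + 1),
      c k * (corner K (delta K (B K (p - k) k))).coeff (p + 1 - l) = 0 := by
    have := congrArg (fun a => (corner K a).coeff (p + 1 - l)) hd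
    simpa [map_sum, finsetSum_coeff] using this
  -- Only the term of index `0` contains `X ^ (p + 1)`; its lower terms interfere with the other
  -- indices, so it has to be removed first.
  have h0 : c 0 = 0 := by
    have h := key 0
    rw [Finset.sum_eq_single 0] at h
    · rw [Nat.sub_zero, Nat.sub_zero, coeff_corner_delta_B_zero K hp] at h
      exact (mul_eq_zero.1 h).resolve_right two_ne_zero
    · intro k hk hk0
      rw [Finset.mem_range] at hk
      rw [coeff_corner_delta_B K (by omega) (by omega) (by omega), if_neg hk0, mul_zero]
    · simp
  refine Finset.sum_eq_zero fun l hl => ?_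
  rw [Finset.mem_range] at hl
  have h := key l
  rw [Finset.sum_eq_single l] at h
  · rcases Nat.eq_zero_or_pos l with rfl | hl0
    · rw [h0, zero_smul]
    · rw [coeff_corner_delta_B K hl0 (by omega) (by omega), if_pos rfl, mul_one] at h
      rw [h, zero_smul]
  · intro k hk hkl
    rw [Finset.mem_range] at hk
    rcases Nat.eq_zero_or_pos k with rfl | hk0
    · rw [h0, zero_mul]
    · rw [coeff_corner_delta_B K hk0 (by omega) (by omega), if_neg hkl, mul_zero]
  · exact fun hl' => absurd (Finset.mem_range.2 hl) hl'

end FreeLieConstants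

theorem mainTheorem5 {K : Type*} [Field K] [CharZero K] (f : FreeLieConstants.L K) (hf0 : f ≠ 0)
    (p q n : ℕ) (hf : f ∈ FreeLieConstants.multihomogeneous K p q) (hq : q = 3)
    (hn : p + q = n) :
    f ∈ FreeLieConstants.constants K ↔
      f ∈ LieSubalgebra.lieSpan K (FreeLieConstants.L K)
        ({FreeLieConstants.x K, ⁅FreeLieConstants.y K, FreeLieConstants.x K⁆} ∪
          {g | ∃ k : ℕ, ((n : ℚ) - 2) / 2 ≤ (k : ℚ) ∧ (k : ℚ) ≤ (n : ℚ) - 4 ∧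
            g = FreeLieConstants.cubicGenerator K n k}) := by
  subst hq
  refine ⟨fun hd => ?_, fun h => FreeLieConstants.cubicSubalgebra_le_constants K n h⟩
  obtain ⟨a, ha, t, ht, rfl⟩ :=
    Submodule.mem_sup.1 (FreeLieConstants.multihomogeneous_le_sup K hn hf)
  have hda : FreeLieConstants.delta K a = 0 :=
    FreeLieConstants.cubicSubalgebra_le_constants K n ha
  have hdt : FreeLieConstants.delta K (a + t) = 0 := hd
  rw [map_add, hda, zero_add] at hdt
  rw [FreeLieConstants.eq_zero_of_mem_complementSpan K ht hdt, add_zero]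
  exact ha
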